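/- All graphs are finite and may have loops and parallel edges; an edge consists of two distinct half-edges, each incident on one vertex, and a graph is 4-regular if every vertex is incident on exactly four half-edges. A circuit is a closed trail: it uses no half-edge twice, but may visit a vertex more than once. An oriented Euler system $C$ of a 4-regular graph $F$ consists of one oriented circuit for each connected component of $F$, which includes every edge of that component. The interlacement graph $\mathcal{I}(C)$ is the simple graph on $V(F)$ in which distinct vertices $v,w$ are adjacent if and only if they appear on a circuit of $C$ in the order $vwvw$ or $wvwv$; a simple graph isomorphic to an interlacement graph is a circle graph. For a simple graph $G$ with adjacency matrix $A(G)$, let $M[IAS(G)]$ be the matroid represented over $GF(2)$ by the matrix $IAS(G)=\begin{pmatrix} I & A(G) & I+A(G)\end{pmatrix}$, and denote by $\phi_G(v),\chi_G(v),\psi_G(v)$ the elements corresponding to the $v$ columns of the three blocks, and by $W(G)$ the set of all these elements. A subtransversal of $W(G)$ is a subset that contains at most one of $\phi_G(v),\chi_G(v),\psi_G(v)$ for each $v\in V(G)$. The isotropic 3-matroid $\mathcal{Z}_3(G)$ is the triple $(W(G),\Omega,r)$, where $\Omega=\{\{\phi_G(v),\chi_G(v),\psi_G(v)\} : v\in V(G)\}$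 and $r$ is the restriction of the rank function of $M[IAS(G)]$ to the subtransversals. A matroid on $W(G)$ is a sheltering matroid for $\mathcal{Z}_3(G)$ if its rank function agrees with $r$ on all subtransversals, and a strict sheltering matroid if moreover its rank is $|V(G)|$. $\mathcal{Z}_3(G)$ is representable over a field $\mathbb{F}$ if it has a sheltering matroid that is represented by a matrix over $\mathbb{F}$. Let $C$ be an oriented Euler system of a 4-regular graph $F$. For each $v\in V(F)$ let $C_{\Gamma^o}(v)$ be one of the two fundamental circuits of $C$ at $v$, i.e. the circuits obtained by following a circuit of $C$ from $v$ to its next return to $v$, oriented consistently with $C$, and let $\Gamma^o=\{C_{\Gamma^o}(v) : v\in V(F)\}$ (it is not required that these circuits avoid common base edges). Denote the two passages of $C$ through $v$ by $v^-$ and $v^+$, so that $C$ traverses $v^-$, then $C_{\Gamma^o}(v)$, then $v^+$. Let $IAS_{\Gamma^o}(C)=\begin{pmatrix} I & A & B\end{pmatrix}$ be the integer matrix in which $I$ is the $V(F)\times V(F)$ identity matrix; for $v\ne w$, $A_{vw}$ is $1$ if $C_{\Gamma^o}(v)$ includes $w^+$ but not $w^-$, is $-1$ if it includes $w^-$ but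 not $w^+$, and is $0$ otherwise, and $B_{vw}\in\{0,1,2\}$ is the number of the passages $w^-,w^+$ that $C_{\Gamma^o}(v)$ includes; and $A_{vv}=0$, $B_{vv}=1$. The $v$ columns of $I,A,B$ are identified with the elements $\phi_{\mathcal{I}(C)}(v),\chi_{\mathcal{I}(C)}(v),\psi_{\mathcal{I}(C)}(v)$ of $W(\mathcal{I}(C))$. Then the matroid represented over $\mathbb{R}$ by $IAS_{\Gamma^o}(C)$ is a strict sheltering matroid for $\mathcal{Z}_3(\mathcal{I}(C))$. Hence $\mathcal{Z}_3(G)$ is representable over $\mathbb{R}$ for every circle graph $G$. -/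

import Mathlib

universe u v w

/-- A graph, possibly with loops and parallel edges, given by its half-edges: every half-edge `h`
is incident on the vertex `vert h`, and the edges are the pairs `{h, mate h}`. -/
structure HalfEdgeGraph (V : Type u) (H : Type v) where
  vert : H → V
  mate : H → H
  mate_mate : ∀ h, mate (mate h) = h
  mate_ne : ∀ h, mate h ≠ h

namespace HalfEdgeGraph

variable {V : Type u} {H : Type v} (F : HalfEdgeGraph V H)

/-- Every vertex is incident on exactly four half-edges. -/
def IsFourRegular : Prop :=
  ∀ x : V, {h : H | F.vert h = x}.ncard = 4

/-- The simple graph in which distinct vertices are adjacent if an edge of `F` joins them. -/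
def toSimpleGraph : SimpleGraph V :=
  SimpleGraph.fromRel fun x y => ∃ h : H, F.vert h = x ∧ F.vert (F.mate h) = y

/-- The connected components of `F`. -/
abbrev Component : Type u :=
  F.toSimpleGraph.ConnectedComponent

/-- An oriented circuit (a closed trail `v₁, h'₁, h₂, v₂, h'₂, …, hₖ = h₁, vₖ = v₁` with pairwise
distinct half-edges), up to the choice of the starting point. It is recorded as the cyclic
sequence `h'₁, h'₂, …` of the initial half-edges of its directed edges; the edge that leaves
through `h'ᵢ` arrives through `mate h'ᵢ`, at the vertex on which `h'ᵢ₊₁` is incident. -/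
structure OrientedCircuit where
  dep : Cycle H
  ne_nil : dep ≠ Cycle.nil
  chain : dep.Chain fun a b => F.vert (F.mate a) = F.vert b
  nodup : dep.Nodup
  mate_notMem : ∀ a ∈ dep, F.mate a ∉ dep

variable {F}

/-- The passages of an oriented circuit through vertices: the pairs `(h, h')` of half-edges such
that the circuit arrives at a vertex through `h` and next departs from it through `h'`. (If the
circuit is started at `h'`, then it finally arrives through `h`.) -/
def OrientedCircuit.passages (γ : F.OrientedCircuit) : Set (H × H) :=
  {p | ∃ (a : H) (l : List H), γ.dep = ((a :: l : List H) : Cycle H) ∧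
    p = (F.mate ((a :: l).getLast (List.cons_ne_nil a l)), a)}

/-- `γ` is an Euler circuit of the component `K`: it includes precisely the edges of `K`. -/
def OrientedCircuit.IsEulerCircuit (γ : F.OrientedCircuit) (K : F.Component) : Prop :=
  ∀ h : H, (h ∈ γ.dep ∨ F.mate h ∈ γ.dep) ↔
    F.toSimpleGraph.connectedComponentMk (F.vert h) = K

variable (F)

/-- An oriented Euler system: one oriented Euler circuit for each connected component. -/
structure OrientedEulerSystem where
  circuit : F.Component → F.OrientedCircuit
  isEulerCircuit : ∀ K, (circuit K).IsEulerCircuit K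

namespace OrientedEulerSystem

variable {F}
variable (C : F.OrientedEulerSystem)

/-- The passages of the circuits of `C` through vertices. -/
def passages : Set (H × H) :=
  ⋃ K, (C.circuit K).passages

/-- `x` and `y` appear on one of the circuits of `C` in the order `x y x y` or `y x y x`. -/
def Interlaced (x y : V) : Prop :=
  ∃ (K : F.Component) (l : List V), (l : Cycle V) = (C.circuit K).dep.map F.vert ∧
    ([x, y, x, y].Sublist l ∨ [y, x, y, x].Sublist l)

/-- The interlacement graph `𝓘(C)`. -/
def interlacementGraph : SimpleGraph V where
  Adj x y := x ≠ y ∧ C.Interlaced x y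
  symm := ⟨by
    rintro x y ⟨hne, K, l, hl, h⟩
    exact ⟨hne.symm, K, l, hl, h.symm⟩⟩
  loopless := ⟨fun _ h => h.1 rfl⟩

/-- `γ` is a consistently oriented fundamental circuit of `C` at `x`: it is obtained by following
a circuit of `C`, in accord with its orientation, from `x` until its next return to `x`. -/
def IsFundamentalCircuit (x : V) (γ : F.OrientedCircuit) : Prop :=
  ∃ (K : F.Component) (h k : H) (l l' : List H),
    (C.circuit K).dep = ((h :: l ++ k :: l' : List H) : Cycle H) ∧
    γ.dep = ((h :: l : List H) : Cycle H) ∧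
    F.vert h = x ∧ F.vert k = x ∧ ∀ a ∈ l, F.vert a ≠ x

/-- The passage `p` of `C` through `y` is `y⁻`: it is followed by the fundamental circuit `Γ y`,
i.e., it departs from `y` along `Γ y`. -/
def IsMinus (Γ : V → F.OrientedCircuit) (y : V) (p : H × H) : Prop :=
  p ∈ C.passages ∧ F.vert p.2 = y ∧ p.2 ∈ (Γ y).dep

/-- The passage `p` of `C` through `y` is `y⁺`: it is preceded by the fundamental circuit `Γ y`,
i.e., it arrives at `y` along `Γ y`. -/
def IsPlus (Γ : V → F.OrientedCircuit) (y : V) (p : H × H) : Prop :=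
  p ∈ C.passages ∧ F.vert p.1 = y ∧ F.mate p.1 ∈ (Γ y).dep

/-- The fundamental circuit `Γ x` includes the passage `y⁻`. -/
def IncludesMinus (Γ : V → F.OrientedCircuit) (x y : V) : Prop :=
  ∃ p ∈ (Γ x).passages, C.IsMinus Γ y p

/-- The fundamental circuit `Γ x` includes the passage `y⁺`. -/
def IncludesPlus (Γ : V → F.OrientedCircuit) (x y : V) : Prop :=
  ∃ p ∈ (Γ x).passages, C.IsPlus Γ y p

end OrientedEulerSystem

end HalfEdgeGraph

/-- The three labels `φ`, `χ`, `ψ`. -/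
inductive IsoLabel : Type
  | phi
  | chi
  | psi

/-- The ground set `W(G)` of the isotropic matroid of a graph `G` with vertex set `V`: the pairs
`(x, phi)`, `(x, chi)`, `(x, psi)` are the elements `φ_G(x)`, `χ_G(x)`, `ψ_G(x)`. -/
abbrev IsoGround (V : Type u) : Type u := V × IsoLabel

instance : Finite IsoLabel :=
  Finite.of_surjective (fun i : Fin 3 => ![IsoLabel.phi, IsoLabel.chi, IsoLabel.psi] i) (by
    rintro (_ | _ | _)
    exacts [⟨0, rfl⟩, ⟨1, rfl⟩, ⟨2, rfl⟩])

/-- The matrix `(P Q R)`, whose columns `φ(y)`, `χ(y)`, `ψ(y)` are the `y` columns of `P`, `Q`,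
`R`, respectively. -/
def blockMatrix {V : Type u} {R : Type w} (P Q S : Matrix V V R) : Matrix V (IsoGround V) R :=
  fun x e => match e with
    | (y, IsoLabel.phi) => P x y
    | (y, IsoLabel.chi) => Q x y
    | (y, IsoLabel.psi) => S x y

open Classical in
/-- The matrix `IAS(G) = (I  A(G)  I + A(G))` over the field with two elements. -/
noncomputable def IAS {V : Type u} (G : SimpleGraph V) : Matrix V (IsoGround V) (ZMod 2) :=
  blockMatrix 1 (G.adjMatrix (ZMod 2)) (1 + G.adjMatrix (ZMod 2))

namespace HalfEdgeGraph.OrientedEulerSystem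

variable {V : Type u} {H : Type v} {F : HalfEdgeGraph V H} (C : F.OrientedEulerSystem)
  (Γ : V → F.OrientedCircuit)

open Classical in
/-- The middle block of the signed matrix `IAS_Γ(C)`. -/
noncomputable def signedA : Matrix V V ℤ := fun x y =>
  if x ≠ y ∧ C.IncludesPlus Γ x y ∧ ¬ C.IncludesMinus Γ x y then 1
  else if x ≠ y ∧ C.IncludesMinus Γ x y ∧ ¬ C.IncludesPlus Γ x y then -1
  else 0

open Classical in
/-- The last block of the signed matrix `IAS_Γ(C)`. -/
noncomputable def signedB : Matrix V V ℤ := fun x y =>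
  if x ≠ y ∧ ¬ C.IncludesPlus Γ x y ∧ ¬ C.IncludesMinus Γ x y then 0
  else if x ≠ y ∧ C.IncludesPlus Γ x y ∧ C.IncludesMinus Γ x y then 2
  else 1

open Classical in
/-- The integer matrix `IAS_Γ(C) = (I  A  B)`. -/
noncomputable def signedIAS : Matrix V (IsoGround V) ℤ :=
  blockMatrix 1 (C.signedA Γ) (C.signedB Γ)

end HalfEdgeGraph.OrientedEulerSystem

/-- The matroid represented by a matrix over a field: its elements are (the indices of) the
columns, and a set is independent if its columns are linearly independent. -/
noncomputable def matrixMatroid {m : Type u} {E : Type v} {𝕜 : Type w} [Finite E] [Field 𝕜]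
    (A : Matrix m E 𝕜) : Matroid E :=
  (IndepMatroid.ofFinite (E := Set.univ) Set.finite_univ
    (Indep := fun I => LinearIndepOn 𝕜 A.col I)
    (indep_empty := linearIndepOn_empty 𝕜 A.col)
    (indep_subset := fun _ _ hJ hIJ => hJ.mono hIJ)
    (indep_aug := by
      intro I J hI hJ hlt
      by_contra hcon
      push Not at hcon
      have hsub : A.col '' J ⊆ Submodule.span 𝕜 (A.col '' I) := by
        rintro _ ⟨e, he, rfl⟩
        by_cases heI : e ∈ I
        · exact Submodule.subset_span ⟨e, heI, rfl⟩
        · by_contra hmem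
          exact hcon e he heI (hI.insert hmem)
      have h1 : Module.finrank 𝕜 (Submodule.span 𝕜 (A.col '' J)) ≤
          Module.finrank 𝕜 (Submodule.span 𝕜 (A.col '' I)) := by
        have : FiniteDimensional 𝕜 (Submodule.span 𝕜 (A.col '' I)) :=
          FiniteDimensional.span_of_finite 𝕜 (Set.toFinite _)
        exact Submodule.finrank_mono (Submodule.span_le.2 hsub)
      have h2 : ∀ K : Set E, LinearIndepOn 𝕜 A.col K →
          Module.finrank 𝕜 (Submodule.span 𝕜 (A.col '' K)) = K.ncard := by
        intro K hK
        have := Fintype.ofFinite K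
        have h3 := finrank_span_eq_card hK
        rw [Set.image_eq_range, h3, Set.ncard_eq_toFinset_card', Set.toFinset_card]
      rw [h2 I hI, h2 J hJ] at h1
      omega)
    (subset_ground := fun _ _ => Set.subset_univ _)).matroid

/-- `T` contains exactly one element of each member of the partition `Ω` of `U`. -/
def IsTransversal {U : Type u} (Ω : Set (Set U)) (T : Set U) : Prop :=
  ∀ ω ∈ Ω, ∃! e, e ∈ T ∩ ω

/-- A subset of a transversal. -/
def IsSubtransversal {U : Type u} (Ω : Set (Set U)) (S : Set U) : Prop :=
  ∃ T, IsTransversal Ω T ∧ S ⊆ T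

/-- The data `(U, Ω, r)` of a multimatroid given by its rank function: a partition `Ω` of `U`, and
a function `r` that is defined on the subtransversals only. -/
structure RankTriple (U : Type u) where
  Ω : Set (Set U)
  isPartition : Setoid.IsPartition Ω
  r : {S : Set U // IsSubtransversal Ω S} → ℕ∞

/-- The matroid `M` (with ground set `U`) shelters `Z`. -/
def RankTriple.IsShelteredBy {U : Type u} (Z : RankTriple U) (M : Matroid U) : Prop :=
  M.E = Set.univ ∧ ∀ S : {S : Set U // IsSubtransversal Z.Ω S}, M.eRk S = Z.r S

/-- `Z` is representable over the field `𝕜`: there is a matrix over `𝕜` (with finitely many rows)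
whose columns are indexed by `U`, and whose rank function agrees with that of `Z` on the
subtransversals. -/
def RankTriple.IsRepresentable {U : Type u} [Finite U] (Z : RankTriple U) (𝕜 : Type w)
    [Field 𝕜] : Prop :=
  ∃ (n : ℕ) (B : Matrix (Fin n) U 𝕜), Z.IsShelteredBy (matrixMatroid B)

/-- The isotropic 3-matroid `𝓩₃(G) = (W(G), Ω, r)` of the simple graph `G`: `Ω` consists of the
sets `{φ_G(x), χ_G(x), ψ_G(x)}`, and `r` is the restriction of the rank function of the isotropic
matroid `M[IAS(G)]`. -/
noncomputable def isotropicThreeMatroid {V : Type u} [Finite V] (G : SimpleGraph V) :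
    RankTriple (IsoGround V) where
  Ω := Set.range fun x : V => {(x, IsoLabel.phi), (x, IsoLabel.chi), (x, IsoLabel.psi)}
  isPartition := by
    refine ⟨?_, ?_⟩
    · rintro ⟨x, hx⟩
      exact (Set.insert_nonempty _ _).ne_empty hx
    · rintro ⟨x, i⟩
      refine ⟨{(x, IsoLabel.phi), (x, IsoLabel.chi), (x, IsoLabel.psi)},
        ⟨⟨x, rfl⟩, by cases i <;> simp⟩, ?_⟩
      rintro _ ⟨⟨y, rfl⟩, hy⟩
      have hxy : x = y := by
        simp only [Set.mem_insert_iff, Set.mem_singleton_iff, Prod.mk.injEq] at hy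
        rcases hy with h | h | h <;> exact h.1
      subst hxy
      rfl
  r := fun S => (matrixMatroid (IAS G)).eRk S

/-- `M` is a strict sheltering matroid for `𝓩₃(G)`: a sheltering matroid of rank `|V(G)|`. -/
def IsStrictShelteringMatroid {V : Type u} [Finite V] (G : SimpleGraph V)
    (M : Matroid (IsoGround V)) : Prop :=
  (isotropicThreeMatroid G).IsShelteredBy M ∧ M.eRank = ENat.card V

/-- `G` is a circle graph: it is, up to isomorphism, the interlacement graph of an Euler system of
a 4-regular graph. -/
def IsCircleGraph {V : Type u} (G : SimpleGraph V) : Prop :=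
  ∃ (V' H : Type) (_ : Finite V') (F : HalfEdgeGraph V' H) (_ : F.IsFourRegular)
    (C : F.OrientedEulerSystem), Nonempty (G ≃g C.interlacementGraph)

/-! A subtransversal picks at most one label `τ y` at each vertex, so only systems with one column
per vertex matter. Modulo 2 the signed matrix is `IAS` of the interlacement graph
(`signedIAS_map_zmod_two`), since `x` and `y` are interlaced exactly when one of the two departures
at `y` lies on the fundamental circuit at `x` (`interlaced_iff`). Independence modulo 2 then gives
independence over ℝ, as for any integer matrix (`linearIndependent_intCast_of_zmod_two`). The
converse is special to this matrix.

For it, kernel vectors are read as potentials. The label at `y` pairs the half-edges there: φ keeps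
the passages of `C`, χ joins arrivals to departures in the other way, ψ joins the two arrivals and
the two departures. Let `g` be a function on the directed edges of `C` that agrees on paired
half-edges, and let `z y` be its jump across the pairing at `y`. Telescoping `g` along the
fundamental circuit at `x` gives the equation of row `x`, so `z` is a kernel vector over any ring
(`IsPotential.row_sum_eq_zero`). Over GF(2) every kernel vector arises so (`exists_isPotential`).
The conditions on `g` are mere equalities of values, so reading 0 and 1 as real numbers yields a
real kernel vector with the same support (`IsPotential.exists_lift`). -/

/-! ### Cyclic sequences, and potentials along lists -/

namespace Cycle

variable {α : Type*}

theorem coe_append_comm (l l' : List α) : ((l ++ l' : List α) : Cycle α) = (l' ++ l : List α) :=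
  coe_eq_coe.2 List.isRotated_append

theorem exists_append_of_coe_eq {l l' : List α} (h : (l : Cycle α) = l') :
    ∃ s t, l = s ++ t ∧ l' = t ++ s := by
  obtain ⟨n, hn, rfl⟩ := List.isRotated_iff_mod.1 (coe_eq_coe.1 h)
  exact ⟨l.take n, l.drop n, (List.take_append_drop n l).symm, List.rotate_eq_drop_append_take hn⟩

theorem tail_eq_of_coe_cons_eq {a : α} {l l' : List α} (hn : (a :: l).Nodup)
    (h : ((a :: l : List α) : Cycle α) = (a :: l' : List α)) : l = l' := by
  obtain ⟨s, t, h₁, h₂⟩ := exists_append_of_coe_eq h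
  rcases s with _ | ⟨b, s⟩
  · rw [List.nil_append] at h₁
    rw [List.append_nil, ← h₁] at h₂
    exact (List.cons.inj h₂).2.symm
  · rcases t with _ | ⟨c, t⟩
    · simp_all
    · simp only [List.cons_append, List.cons.injEq] at h₁ h₂
      obtain ⟨rfl, rfl⟩ := h₁
      obtain ⟨rfl, rfl⟩ := h₂
      simp at hn

theorem exists_eq_coe_cons {a : α} {s : Cycle α} (ha : a ∈ s) :
    ∃ l : List α, s = (a :: l : List α) := by
  induction s using Quotient.inductionOn' with
  | _ L =>
    obtain ⟨s, t, rfl⟩ := List.append_of_mem (mem_coe_iff.1 ha)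
    exact ⟨t ++ s, coe_append_comm s (a :: t)⟩

end Cycle

namespace List

variable {α : Type*}

theorem exists_append_cons_of_mem_of_first {p : α → Prop} {l : List α} {a : α} (ha : a ∈ l)
    (hp : p a) : ∃ s b t, l = s ++ b :: t ∧ p b ∧ ∀ c ∈ s, ¬ p c := by
  induction l with
  | nil => simp at ha
  | cons c l ih =>
    by_cases hc : p c
    · exact ⟨[], c, l, rfl, hc, by simp⟩
    · obtain ⟨s, b, t, rfl, hb, hs⟩ := ih (by
        rcases mem_cons.1 ha with rfl | h
        exacts [absurd hp hc, h])
      refine ⟨c :: s, b, t, rfl, hb, ?_⟩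
      rintro d (_ | ⟨_, hd⟩)
      exacts [hc, hs d hd]

/-- The values are fixed from the last entry backwards; as entries are distinct, setting the head
disturbs nothing. -/
theorem exists_isChain_add {R : Type*} [AddCommGroup R] (J : α → R) {l : List α} (hl : l.Nodup) :
    ∃ g : α → R, l.IsChain fun a b => g b = g a + J b := by
  classical
  induction l with
  | nil => exact ⟨0, .nil⟩
  | cons a l ih =>
    obtain ⟨g, hg⟩ := ih hl.of_cons
    rcases l with _ | ⟨b, l⟩
    · exact ⟨0, .singleton a⟩
    · have ha : ∀ c ∈ b :: l, c ≠ a := fun c hc h => (nodup_cons.1 hl).1 (h ▸ hc)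
      refine ⟨Function.update g a (g b - J b), .cons_cons ?_ ?_⟩
      · simp [ha b (by simp)]
      · rw [isChain_iff_getElem] at hg ⊢
        intro i hi
        have h := hg i hi
        rwa [Function.update_of_ne (ha _ (getElem_mem _)),
          Function.update_of_ne (ha _ (getElem_mem _))]

/-- Telescoping. A jump belongs to the entry it leads into, so the head contributes none. -/
theorem IsChain.getLast_eq_add_sum {R : Type*} [AddCommGroup R] {J g : α → R} {a : α} {l : List α}
    (h : (a :: l).IsChain fun a b => g b = g a + J b) :
    g ((a :: l).getLast (cons_ne_nil a l)) = g a + (l.map J).sum := by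
  induction l generalizing a with
  | nil => simp
  | cons b l ih =>
    rw [isChain_cons_cons] at h
    rw [getLast_cons_cons, ih h.2, h.1]
    simp [add_assoc]

end List

/-! ### Linear algebra: sections, and reduction modulo 2 -/

open Classical in
/-- Linear independence of the columns selected by a subset of a transversal. -/
theorem linearIndepOn_col_iff_of_section {V L m K : Type*} [Fintype V] [Field K]
    (A : Matrix m (V × L) K) (τ : V → L) {S : Set (V × L)} (hS : ∀ e ∈ S, e.2 = τ e.1) :
    LinearIndepOn K A.col S ↔ ∀ z : V → K, (∀ y, (y, τ y) ∉ S → z y = 0) →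
      (∀ x, ∑ y, A x (y, τ y) * z y = 0) → z = 0 := by
  have hinj : Set.InjOn (fun y => (y, τ y)) {y | (y, τ y) ∈ S} := fun a _ b _ h => congrArg Prod.fst h
  have himg : S = (fun y => (y, τ y)) '' {y | (y, τ y) ∈ S} := by
    ext ⟨y, l⟩
    constructor
    · intro h
      have := hS _ h
      obtain rfl : l = τ y := this
      exact ⟨y, h, rfl⟩
    · rintro ⟨y', h, hy⟩
      exact hy ▸ h
  have key : LinearIndepOn K A.col S ↔
      LinearIndepOn K (fun y => A.col (y, τ y)) {y | (y, τ y) ∈ S} := by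
    conv_lhs => rw [himg]
    exact ⟨fun h => h.comp_of_image hinj, fun h => h.image_of_comp⟩
  rw [key]
  rw [linearIndepOn_iff']
  constructor
  · intro h z hz hsum
    have := h (Finset.univ.filter fun y => (y, τ y) ∈ S) z (by
      intro y; simp) (by
      rw [Finset.sum_filter_of_ne]
      · ext x
        simpa [mul_comm] using hsum x
      · intro y _ hy
        by_contra hyS
        exact hy (by simp [hz y hyS]))
    ext y
    by_cases hy : (y, τ y) ∈ S
    · exact this y (by simpa using hy)
    · exact hz y hy
  · intro h s c hs hsum y hy
    have := h (fun y => if y ∈ s then c y else 0) (fun y hyS => if_neg fun hys => hyS (hs hys))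
      (fun x => by simpa [Finset.sum_ite_mem, mul_comm] using congrFun hsum x)
    simpa [hy] using congrFun this y

theorem Matroid.eRk_eq_of_indep_iff {α : Type*} {M N : Matroid α} {S : Set α}
    (h : ∀ I ⊆ S, M.Indep I ↔ N.Indep I) : M.eRk S = N.eRk S := by
  refine le_antisymm ?_ ?_ <;> rw [Matroid.eRk_le_iff] <;> intro I hI hIM
  · exact ((h I hI).1 hIM).encard_le_eRk_of_subset hI
  · exact ((h I hI).2 hIM).encard_le_eRk_of_subset hI

theorem matrixMatroid_indep {m E K : Type*} [Finite E] [Field K] (A : Matrix m E K) (I : Set E) :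
    (matrixMatroid A).Indep I ↔ LinearIndepOn K A.col I := Iff.rfl

/-- Columns of an integer matrix that are independent modulo `2` are independent over `ℝ`. -/
theorem linearIndependent_intCast_of_zmod_two {m ι : Type*} [Fintype m] [Fintype ι]
    (f : ι → m → ℤ) (h : LinearIndependent (ZMod 2) fun i x => (f i x : ZMod 2)) :
    LinearIndependent ℝ fun i x => (f i x : ℝ) := by
  classical
  let M : Matrix m ι ℤ := fun x i => f i x
  obtain ⟨g, hg⟩ := (Matrix.toLin' (M.map (Int.cast : ℤ → ZMod 2))).exists_leftInverse_of_injective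
    (LinearMap.ker_eq_bot.2 (by
      rw [Matrix.toLin'_apply', Matrix.coe_mulVecLin]
      exact Matrix.mulVec_injective_iff.2 h))
  have hmul : LinearMap.toMatrix' g * M.map (Int.cast : ℤ → ZMod 2) = 1 := by
    rw [← LinearMap.toMatrix'_toLin' (M.map (Int.cast : ℤ → ZMod 2)), ← LinearMap.toMatrix'_comp, hg,
      LinearMap.toMatrix'_id]
  -- An integer lift of the left inverse: `N * M` is the identity modulo 2, so its determinant is
  -- odd and hence nonzero in ℝ.
  let N : Matrix ι m ℤ := (LinearMap.toMatrix' g).map fun a => (a.val : ℤ)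
  have hN : N.map (Int.castRingHom (ZMod 2)) = LinearMap.toMatrix' g := by
    ext i x
    simp [N]
  have hdet : (N * M).det ≠ 0 := by
    intro h0
    have h1 : Int.castRingHom (ZMod 2) (N * M).det = 1 := by
      rw [RingHom.map_det, RingHom.mapMatrix_apply, Matrix.map_mul, hN]
      exact (congrArg Matrix.det hmul).trans Matrix.det_one
    simp [h0] at h1
  have hdet' : ((N * M).map (Int.castRingHom ℝ)).det ≠ 0 := by
    rw [← RingHom.mapMatrix_apply, ← RingHom.map_det]
    simpa using hdet
  have hinj : Function.Injective ((N * M).map (Int.castRingHom ℝ)).mulVec :=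
    Matrix.mulVec_injective_iff_isUnit.2 ((Matrix.isUnit_iff_isUnit_det _).2 hdet'.isUnit)
  refine Matrix.mulVec_injective_iff (M := M.map (Int.castRingHom ℝ)).1 fun a b hab => hinj ?_
  rw [Matrix.map_mul, ← Matrix.mulVec_mulVec, ← Matrix.mulVec_mulVec]
  exact congrArg _ hab

/-! ### Departures of an Euler system -/

namespace HalfEdgeGraph

variable {V : Type u} {H : Type v} {F : HalfEdgeGraph V H}

namespace OrientedCircuit

variable (γ : F.OrientedCircuit)

theorem nodup_of_dep_eq {l : List H} (h : γ.dep = (l : Cycle H)) : l.Nodup :=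
  Cycle.nodup_coe_iff.1 (h ▸ γ.nodup)

theorem vert_mate_getLast {a : H} {l : List H} (h : γ.dep = ((a :: l : List H) : Cycle H)) :
    F.vert (F.mate ((a :: l).getLast (List.cons_ne_nil a l))) = F.vert a := by
  have hc := γ.chain
  rw [h, Cycle.chain_coe_cons, ← List.cons_append, List.isChain_append] at hc
  exact hc.2.2 _ (List.getLast?_eq_getLast_of_ne_nil _) a (by simp)

theorem mem_passages_of_dep_eq_append {s t : List H} {a b : H}
    (h : γ.dep = ((s ++ a :: b :: t : List H) : Cycle H)) : (F.mate a, b) ∈ γ.passages := by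
  refine ⟨b, t ++ (s ++ [a]), ?_, ?_⟩
  · rw [h, show s ++ a :: b :: t = (s ++ [a]) ++ (b :: t) by simp, Cycle.coe_append_comm]
    simp
  · simp [List.getLast_cons]

end OrientedCircuit

namespace OrientedEulerSystem

variable (C : F.OrientedEulerSystem)

theorem component_eq_of_mem {K : F.Component} {h : H} (hh : h ∈ (C.circuit K).dep) :
    F.toSimpleGraph.connectedComponentMk (F.vert h) = K :=
  (C.isEulerCircuit K h).1 (Or.inl hh)

theorem exists_prev : ∃ p : H → H, ∀ (K : F.Component) (a : H) (l : List H),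
    (C.circuit K).dep = ((a :: l : List H) : Cycle H) →
      p a = (a :: l).getLast (List.cons_ne_nil a l) := by
  have : ∀ a : H, ∃ b : H, ∀ (K : F.Component) (l : List H),
      (C.circuit K).dep = ((a :: l : List H) : Cycle H) →
        b = (a :: l).getLast (List.cons_ne_nil a l) := by
    intro a
    by_cases ha : ∃ (K : F.Component) (l : List H),
      (C.circuit K).dep = ((a :: l : List H) : Cycle H)
    · obtain ⟨K, l, hl⟩ := ha
      refine ⟨(a :: l).getLast (List.cons_ne_nil a l), fun K' l' hl' => ?_⟩
      · obtain rfl : K = K' := by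
          rw [← C.component_eq_of_mem (K := K) (h := a) (by simp [hl]),
            C.component_eq_of_mem (K := K') (h := a) (by simp [hl'])]
        obtain rfl := Cycle.tail_eq_of_coe_cons_eq ((C.circuit K).nodup_of_dep_eq hl)
          (hl.symm.trans hl')
        rfl
    -- A half-edge that is no departure of `C` gets an arbitrary predecessor.
    · exact ⟨a, fun K l hl => absurd ⟨K, l, hl⟩ ha⟩
  choose p hp using this
  exact ⟨p, fun K a l => hp a K l⟩

/-- The half-edge through which `C` departs just before departing through `h`. -/
noncomputable def prev (h : H) : H :=
  C.exists_prev.choose h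

theorem prev_eq_getLast {K : F.Component} {a : H} {l : List H}
    (h : (C.circuit K).dep = ((a :: l : List H) : Cycle H)) :
    C.prev a = (a :: l).getLast (List.cons_ne_nil a l) :=
  C.exists_prev.choose_spec K a l h

theorem prev_eq_of_append {K : F.Component} {s t : List H} {a b : H}
    (h : (C.circuit K).dep = ((s ++ a :: b :: t : List H) : Cycle H)) : C.prev b = a := by
  rw [show s ++ a :: b :: t = (s ++ [a]) ++ (b :: t) by simp, Cycle.coe_append_comm,
    List.cons_append] at h
  rw [C.prev_eq_getLast h]
  simp [List.getLast_cons]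

theorem prev_mem {K : F.Component} {h : H} (hh : h ∈ (C.circuit K).dep) :
    C.prev h ∈ (C.circuit K).dep := by
  obtain ⟨l, hl⟩ := Cycle.exists_eq_coe_cons hh
  rw [C.prev_eq_getLast hl, hl, Cycle.mem_coe_iff]
  exact List.getLast_mem _

theorem vert_mate_prev {K : F.Component} {h : H} (hh : h ∈ (C.circuit K).dep) :
    F.vert (F.mate (C.prev h)) = F.vert h := by
  obtain ⟨l, hl⟩ := Cycle.exists_eq_coe_cons hh
  rw [C.prev_eq_getLast hl]
  exact (C.circuit K).vert_mate_getLast hl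

theorem exists_prev_eq {K : F.Component} {h : H} (hh : h ∈ (C.circuit K).dep) :
    ∃ k ∈ (C.circuit K).dep, C.prev k = h := by
  obtain ⟨l, hl⟩ := Cycle.exists_eq_coe_cons hh
  rcases l with _ | ⟨b, l⟩
  · exact ⟨h, hh, by simp [C.prev_eq_getLast hl]⟩
  · exact ⟨b, by simp [hl], C.prev_eq_of_append (s := []) hl⟩

theorem mem_passages {p : H × H} :
    p ∈ C.passages ↔ ∃ K, p.2 ∈ (C.circuit K).dep ∧ p.1 = F.mate (C.prev p.2) := by
  simp only [passages, Set.mem_iUnion]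
  refine exists_congr fun K => ⟨?_, ?_⟩
  · rintro ⟨a, l, hl, rfl⟩
    exact ⟨by simp [hl], by rw [C.prev_eq_getLast hl]⟩
  · rintro ⟨h₂, h₁⟩
    obtain ⟨l, hl⟩ := Cycle.exists_eq_coe_cons h₂
    exact ⟨_, l, hl, Prod.ext (by rw [h₁, C.prev_eq_getLast hl]) rfl⟩

theorem mate_prev_notMem {K : F.Component} {h : H} (hh : h ∈ (C.circuit K).dep) :
    F.mate (C.prev h) ∉ (C.circuit K).dep :=
  (C.circuit K).mate_notMem _ (C.prev_mem hh)

theorem mate_injective : Function.Injective F.mate :=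
  Function.LeftInverse.injective F.mate_mate

/-- Every vertex of a 4-regular graph has two departures. -/
theorem exists_two_departures (hF : F.IsFourRegular) (x : V) :
    ∃ h k : H, h ≠ k ∧ F.vert h = x ∧ F.vert k = x ∧
      h ∈ (C.circuit (F.toSimpleGraph.connectedComponentMk x)).dep ∧
      k ∈ (C.circuit (F.toSimpleGraph.connectedComponentMk x)).dep := by
  set K := F.toSimpleGraph.connectedComponentMk x with hK
  by_contra hcon
  push Not at hcon
  have hD : {h | F.vert h = x ∧ h ∈ (C.circuit K).dep}.Subsingleton := by
    rintro a ⟨ha, ha'⟩ b ⟨hb, hb'⟩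
    by_contra hab
    exact hcon a b hab ha hb ha' hb'
  -- Each arrival at `x` is followed by a departure from `x` that determines it, so a single
  -- departure would leave at most two half-edges at `x`.
  have hA : {h | F.vert h = x ∧ F.mate h ∈ (C.circuit K).dep}.Subsingleton := by
    rintro a ⟨ha, ha'⟩ b ⟨hb, hb'⟩
    obtain ⟨c, hc, hca⟩ := C.exists_prev_eq ha'
    obtain ⟨d, hd, hdb⟩ := C.exists_prev_eq hb'
    have hcx : F.vert c = x := by rw [← C.vert_mate_prev hc, hca, F.mate_mate, ha]
    have hdx : F.vert d = x := by rw [← C.vert_mate_prev hd, hdb, F.mate_mate, hb]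
    obtain rfl := hD ⟨hcx, hc⟩ ⟨hdx, hd⟩
    exact F.mate_mate a ▸ F.mate_mate b ▸ congrArg F.mate (hca.symm.trans hdb)
  have hsub : {h | F.vert h = x} ⊆ {h | F.vert h = x ∧ h ∈ (C.circuit K).dep} ∪
      {h | F.vert h = x ∧ F.mate h ∈ (C.circuit K).dep} := by
    intro h hh
    rcases (C.isEulerCircuit K h).2 (by rw [show F.vert h = x from hh]) with h' | h'
    exacts [Or.inl ⟨hh, h'⟩, Or.inr ⟨hh, h'⟩]
  have h1 := Set.ncard_le_ncard hsub (hD.finite.union hA.finite)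
  have h2 := Set.ncard_union_le {h | F.vert h = x ∧ h ∈ (C.circuit K).dep}
    {h | F.vert h = x ∧ F.mate h ∈ (C.circuit K).dep}
  have h3 := (Set.ncard_le_one hD.finite).2 hD
  have h4 := (Set.ncard_le_one hA.finite).2 hA
  have h5 := hF x
  omega

theorem exists_isFundamentalCircuit (hF : F.IsFourRegular) (x : V) :
    ∃ γ : F.OrientedCircuit, C.IsFundamentalCircuit x γ := by
  obtain ⟨h, k, hne, hh, hk, hhm, hkm⟩ := C.exists_two_departures hF x
  obtain ⟨m, hm⟩ := Cycle.exists_eq_coe_cons hhm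
  have hkm' : k ∈ m := by
    rw [hm, Cycle.mem_coe_iff, List.mem_cons] at hkm
    exact hkm.resolve_left hne.symm
  obtain ⟨l, k', l', rfl, hk', hl⟩ :=
    List.exists_append_cons_of_mem_of_first (p := fun a => F.vert a = x) hkm' hk
  have hnd := (C.circuit _).nodup_of_dep_eq hm
  have hsub : ∀ a ∈ ((h :: l : List H) : Cycle H),
      a ∈ (C.circuit (F.toSimpleGraph.connectedComponentMk x)).dep := by
    intro a ha
    rw [Cycle.mem_coe_iff] at ha
    rw [hm, Cycle.mem_coe_iff, ← List.cons_append]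
    exact List.mem_append_left _ ha
  refine ⟨⟨(h :: l : List H), by simp, ?_, ?_, ?_⟩, _, h, k', l, l', hm, rfl, hh, hk', hl⟩
  · have hc := (C.circuit (F.toSimpleGraph.connectedComponentMk x)).chain
    rw [hm, Cycle.chain_coe_cons,
      show h :: (l ++ k' :: l' ++ [h]) = (h :: l) ++ (k' :: (l' ++ [h])) by simp,
      List.isChain_append] at hc
    rw [Cycle.chain_coe_cons, ← List.cons_append, List.isChain_append]
    refine ⟨hc.1, .singleton _, fun a ha b hb => ?_⟩
    obtain rfl : h = b := by simpa using hb
    rw [hc.2.2 a ha k' (by simp), hk', hh]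
  · rw [← List.cons_append] at hnd
    exact Cycle.nodup_coe_iff.2 hnd.of_append_left
  · exact fun a ha ha' => (C.circuit _).mate_notMem a (hsub a ha) (hsub _ ha')

/-! ### The two arcs at a vertex -/

/-- A choice of the two departures at every vertex, and of the arcs between them. -/
structure Splitting (Γ : V → F.OrientedCircuit) where
  first : V → H
  second : V → H
  arc : V → List H
  coarc : V → List H
  dep_eq : ∀ x, (C.circuit (F.toSimpleGraph.connectedComponentMk x)).dep =
    ((first x :: arc x ++ second x :: coarc x : List H) : Cycle H)
  dep_fundamental : ∀ x, (Γ x).dep = ((first x :: arc x : List H) : Cycle H)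
  vert_first : ∀ x, F.vert (first x) = x
  vert_second : ∀ x, F.vert (second x) = x
  vert_ne : ∀ x, ∀ a ∈ arc x, F.vert a ≠ x

theorem exists_splitting {Γ : V → F.OrientedCircuit}
    (hΓ : ∀ x, C.IsFundamentalCircuit x (Γ x)) : Nonempty (C.Splitting Γ) := by
  choose K h k l l' h₁ h₂ h₃ h₄ h₅ using hΓ
  refine ⟨⟨h, k, l, l', fun x => ?_, h₂, h₃, h₄, h₅⟩⟩
  have : F.toSimpleGraph.connectedComponentMk x = K x := by
    have := C.component_eq_of_mem (K := K x) (h := h x) (by simp [h₁])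
    rwa [h₃] at this
  rw [this, h₁]

namespace Splitting

variable {C} {Γ : V → F.OrientedCircuit} (D : C.Splitting Γ)
include D

theorem nodup (x : V) : (D.first x :: D.arc x ++ D.second x :: D.coarc x).Nodup :=
  (C.circuit _).nodup_of_dep_eq (D.dep_eq x)

theorem first_mem (x : V) :
    D.first x ∈ (C.circuit (F.toSimpleGraph.connectedComponentMk x)).dep := by
  simp [D.dep_eq]

theorem second_mem (x : V) :
    D.second x ∈ (C.circuit (F.toSimpleGraph.connectedComponentMk x)).dep := by
  simp [D.dep_eq]

theorem prev_first (x : V) :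
    C.prev (D.first x) = (D.second x :: D.coarc x).getLast (List.cons_ne_nil _ _) := by
  rw [C.prev_eq_getLast (D.dep_eq x)]
  simp [List.getLast_cons]

theorem prev_second (x : V) :
    C.prev (D.second x) = (D.first x :: D.arc x).getLast (List.cons_ne_nil _ _) := by
  have h := D.dep_eq x
  rw [Cycle.coe_append_comm, List.cons_append] at h
  rw [C.prev_eq_getLast h]
  simp [List.getLast_cons]

theorem prev_second_mem (x : V) : C.prev (D.second x) ∈ D.first x :: D.arc x := by
  rw [D.prev_second]
  exact List.getLast_mem _

theorem prev_first_notMem (x : V) : C.prev (D.first x) ∉ D.first x :: D.arc x := by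
  rw [D.prev_first]
  exact fun h => (List.nodup_append.1 (D.nodup x)).2.2 _ h _ (List.getLast_mem _) rfl

theorem first_ne_second (x : V) : D.first x ≠ D.second x :=
  (List.nodup_append.1 (D.nodup x)).2.2 _ (by simp) _ (by simp)

/-- The two departures and the two arrivals preceding them are four distinct half-edges, hence all
those at the vertex; and an arrival is never a departure, since no edge is traversed both ways. -/
theorem eq_first_or_eq_second (hF : F.IsFourRegular) {K : F.Component} {h : H}
    (hh : h ∈ (C.circuit K).dep) : h = D.first (F.vert h) ∨ h = D.second (F.vert h) := by
  obtain rfl := C.component_eq_of_mem hh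
  generalize hx : F.vert h = x at hh ⊢
  have hne : C.prev (D.first x) ≠ C.prev (D.second x) := fun he =>
    D.prev_first_notMem x (he ▸ D.prev_second_mem x)
  have h1 := C.mate_prev_notMem (D.first_mem x)
  have h2 := C.mate_prev_notMem (D.second_mem x)
  have hsub : ({D.first x, D.second x, F.mate (C.prev (D.first x)),
      F.mate (C.prev (D.second x))} : Set H) ⊆ {h | F.vert h = x} := by
    rintro _ (rfl | rfl | rfl | rfl)
    · exact D.vert_first x
    · exact D.vert_second x
    · exact (C.vert_mate_prev (D.first_mem x)).trans (D.vert_first x)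
    · exact (C.vert_mate_prev (D.second_mem x)).trans (D.vert_second x)
  have hcard : ({D.first x, D.second x, F.mate (C.prev (D.first x)),
      F.mate (C.prev (D.second x))} : Set H).ncard = 4 := by
    have h11 : D.first x ≠ F.mate (C.prev (D.first x)) := fun he => h1 (he ▸ D.first_mem x)
    have h12 : D.first x ≠ F.mate (C.prev (D.second x)) := fun he => h2 (he ▸ D.first_mem x)
    have h21 : D.second x ≠ F.mate (C.prev (D.first x)) := fun he => h1 (he ▸ D.second_mem x)
    have h22 : D.second x ≠ F.mate (C.prev (D.second x)) := fun he => h2 (he ▸ D.second_mem x)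
    have h3 := (mate_injective (F := F)).ne hne
    rw [Set.ncard_insert_of_notMem (by simp [D.first_ne_second, h11, h12]),
      Set.ncard_insert_of_notMem (by simp [h21, h22]), Set.ncard_pair h3]
  have heq := Set.eq_of_subset_of_ncard_le hsub (by rw [hcard, hF x])
    (Set.finite_of_ncard_ne_zero (by rw [hF x]; simp))
  have : h ∈ {h | F.vert h = x} := hx
  rw [← heq] at this
  rcases this with rfl | rfl | rfl | rfl
  exacts [Or.inl rfl, Or.inr rfl, absurd hh h1, absurd hh h2]

theorem mem_circuit_of_mem_arc {x : V} {h : H} (hh : h ∈ D.arc x) :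
    h ∈ (C.circuit (F.toSimpleGraph.connectedComponentMk x)).dep := by
  simp [D.dep_eq, hh]

/-- A passage is determined by its departure. The passage of `Γ x` that closes it up is at `x`, so
it does not interfere when `x ≠ y`. -/
theorem includesMinus_iff {x y : V} (hxy : x ≠ y) :
    C.IncludesMinus Γ x y ↔ D.first y ∈ D.arc x := by
  constructor
  · rintro ⟨_, ⟨a, l, hl, rfl⟩, hp, hy, ha⟩
    simp only at hy ha
    have ha' : a ∈ (Γ x).dep := by simp [hl]
    rw [D.dep_fundamental, Cycle.mem_coe_iff, List.mem_cons] at ha ha'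
    have : a = D.first y := ha.resolve_right fun h => D.vert_ne y a h hy
    subst this
    refine ha'.resolve_left fun h => hxy ?_
    rw [← D.vert_first x, ← h, hy]
  · intro h
    obtain ⟨s, t, hst⟩ := List.append_of_mem h
    obtain ⟨s', a, hs'⟩ : ∃ s' a, D.first x :: s = s' ++ [a] :=
      ⟨_, _, (List.dropLast_append_getLast (List.cons_ne_nil _ _)).symm⟩
    have h1 : D.first x :: D.arc x = s' ++ a :: D.first y :: t := by
      rw [hst, ← List.cons_append, hs']; simp
    refine ⟨(F.mate a, D.first y), (Γ x).mem_passages_of_dep_eq_append (s := s') (t := t)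
      (by rw [D.dep_fundamental, h1]), ?_, D.vert_first y, by simp [D.dep_fundamental]⟩
    refine Set.mem_iUnion.2 ⟨F.toSimpleGraph.connectedComponentMk x,
      (C.circuit _).mem_passages_of_dep_eq_append (s := s')
      (t := t ++ D.second x :: D.coarc x) ?_⟩
    rw [D.dep_eq x, h1]; simp

/-- `IsPlus` speaks of the arrival, so the departure has to be identified: it is one of the two at
`y`, and the edge preceding `first y` is not on `Γ y`. -/
theorem includesPlus_iff (hF : F.IsFourRegular) {x y : V} (hxy : x ≠ y) :
    C.IncludesPlus Γ x y ↔ D.second y ∈ D.arc x := by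
  constructor
  · rintro ⟨_, ⟨a, l, hl, rfl⟩, hp, hy, ha⟩
    simp only [F.mate_mate] at hy ha
    have hay : F.vert a = y := ((Γ x).vert_mate_getLast hl).symm.trans hy
    obtain ⟨K, haK, hpa⟩ := C.mem_passages.1 hp
    simp only at haK hpa
    have hpa := mate_injective hpa
    have ha' : a ∈ (Γ x).dep := by simp [hl]
    rw [D.dep_fundamental, Cycle.mem_coe_iff, List.mem_cons] at ha'
    have ha' := ha'.resolve_left fun h => hxy (by rw [← D.vert_first x, ← h, hay])
    rcases D.eq_first_or_eq_second hF haK with h | h <;> rw [hay] at h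
    · rw [hpa, h, D.dep_fundamental, Cycle.mem_coe_iff] at ha
      exact absurd ha (D.prev_first_notMem y)
    · exact h ▸ ha'
  · intro h
    obtain ⟨s, t, hst⟩ := List.append_of_mem h
    obtain ⟨s', a, hs'⟩ : ∃ s' a, D.first x :: s = s' ++ [a] :=
      ⟨_, _, (List.dropLast_append_getLast (List.cons_ne_nil _ _)).symm⟩
    have h1 : D.first x :: D.arc x = s' ++ a :: D.second y :: t := by
      rw [hst, ← List.cons_append, hs']; simp
    have h2 : (C.circuit (F.toSimpleGraph.connectedComponentMk x)).dep =
        ((s' ++ a :: D.second y :: (t ++ D.second x :: D.coarc x) : List H) : Cycle H) := by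
      rw [D.dep_eq x, h1]; simp
    have h3 := C.prev_eq_of_append h2
    refine ⟨(F.mate a, D.second y), (Γ x).mem_passages_of_dep_eq_append (s := s') (t := t)
      (by rw [D.dep_fundamental, h1]),
      Set.mem_iUnion.2 ⟨_, (C.circuit _).mem_passages_of_dep_eq_append h2⟩, ?_, ?_⟩
    · simp only
      rw [← h3, C.vert_mate_prev (D.second_mem y), D.vert_second]
    · simp only [F.mate_mate, D.dep_fundamental, Cycle.mem_coe_iff]
      rw [← h3]
      exact D.prev_second_mem y

end Splitting

end OrientedEulerSystem

end HalfEdgeGraph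

/-! ### Interlacement by counting, and the signed matrix modulo 2 -/

theorem List.filter_eq_replicate_of_notMem {α : Type*} [DecidableEq α] {x y : α} {l : List α}
    (hx : x ∉ l) : l.filter (fun a => a = x ∨ a = y) = List.replicate (l.count y) y := by
  rw [← List.filter_eq]
  refine List.filter_congr fun a ha => ?_
  have : a ≠ x := fun h => hx (h ▸ ha)
  simp [this]

/-- The cyclic sequence `x l x l'` alternates between `x` and `y` precisely if `y` occurs once
in `l`. -/
theorem Cycle.exists_alternating_iff {α : Type*} [DecidableEq α] {x y : α} (hxy : x ≠ y)
    {l l' : List α} (hx : x ∉ l) (hx' : x ∉ l') (hy : l.count y + l'.count y = 2) :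
    (∃ r : List α, (r : Cycle α) = (x :: l ++ x :: l' : List α) ∧
      ([x, y, x, y].Sublist r ∨ [y, x, y, x].Sublist r)) ↔ l.count y = 1 := by
  constructor
  · rintro ⟨r, hr, hsub⟩
    obtain ⟨s, t, rfl, hst⟩ := Cycle.exists_append_of_coe_eq hr
    have hrot : (t ++ s).filter (fun a => a = x ∨ a = y) ~r
        (s ++ t).filter (fun a => a = x ∨ a = y) := by
      rw [List.filter_append, List.filter_append]
      exact List.isRotated_append
    have hf : (t ++ s).filter (fun a => a = x ∨ a = y) =
        x :: List.replicate (l.count y) y ++ x :: List.replicate (l'.count y) y := by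
      rw [← hst, List.filter_append, List.filter_cons_of_pos (by simp),
        List.filter_cons_of_pos (by simp), List.filter_eq_replicate_of_notMem hx,
        List.filter_eq_replicate_of_notMem hx']
    have hlen : ((s ++ t).filter (fun a => a = x ∨ a = y)).length = 4 := by
      rw [← hrot.perm.length_eq, hf]
      simp
      omega
    -- Only four entries are `x` or `y`, so the alternating sublist is all of the filtered list.
    have hs : (s ++ t).filter (fun a => a = x ∨ a = y) = [x, y, x, y] ∨
        (s ++ t).filter (fun a => a = x ∨ a = y) = [y, x, y, x] := by
      refine hsub.imp (fun h => ?_) (fun h => ?_) <;>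
      · have h' := h.filter (fun a => a = x ∨ a = y)
        simp only [List.filter_cons, List.filter_nil, true_or, or_true, decide_true, if_true] at h'
        exact (h'.eq_of_length (by rw [hlen]; rfl)).symm
    have hyx := hxy.symm
    obtain ⟨n, hn, hn'⟩ := List.isRotated_iff_mod.1 hrot
    rw [hf] at hn hn'
    obtain ⟨h1, h2⟩ | ⟨h1, h2⟩ | ⟨h1, h2⟩ : (l.count y = 0 ∧ l'.count y = 2) ∨
        (l.count y = 1 ∧ l'.count y = 1) ∨ (l.count y = 2 ∧ l'.count y = 0) := by omega
    -- If both `y` lie in the same arc, the cyclic word is `xxyy`; none of its rotations alternates.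
    · rw [h1, h2] at hn hn'
      simp at hn
      interval_cases n <;> rcases hs with hs | hs <;> rw [hs] at hn' <;>
        simp [List.replicate_succ, hxy, hyx] at hn'
    · exact h1
    · rw [h1, h2] at hn hn'
      simp at hn
      interval_cases n <;> rcases hs with hs | hs <;> rw [hs] at hn' <;>
        simp [List.replicate_succ, hxy, hyx] at hn'
  · intro h
    have h1 : y ∈ l := List.count_pos_iff.1 (by omega)
    have h2 : y ∈ l' := List.count_pos_iff.1 (by omega)
    exact ⟨_, rfl, Or.inl (((List.singleton_sublist.2 h1).cons_cons x).append
      ((List.singleton_sublist.2 h2).cons_cons x))⟩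

namespace HalfEdgeGraph.OrientedEulerSystem.Splitting

variable {V : Type u} {H : Type v} {F : HalfEdgeGraph V H} {C : F.OrientedEulerSystem}
  {Γ : V → F.OrientedCircuit} (D : C.Splitting Γ)
include D

theorem first_notMem_arc (x : V) : D.first x ∉ D.arc x := fun h =>
  D.vert_ne x _ h (D.vert_first x)

theorem second_notMem_arc (x : V) : D.second x ∉ D.arc x := fun h =>
  D.vert_ne x _ h (D.vert_second x)

open Classical in
theorem signedA_apply (hF : F.IsFourRegular) (x y : V) :
    C.signedA Γ x y = (if D.second y ∈ D.arc x then 1 else 0) -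
      (if D.first y ∈ D.arc x then 1 else 0) := by
  by_cases hxy : x = y
  · subst hxy
    simp [signedA, D.first_notMem_arc, D.second_notMem_arc]
  · simp only [signedA, D.includesMinus_iff hxy, D.includesPlus_iff hF hxy]
    split_ifs <;> simp_all

open Classical in
theorem signedB_apply (hF : F.IsFourRegular) (x y : V) :
    C.signedB Γ x y = (if D.second y ∈ D.arc x then 1 else 0) +
      (if D.first y ∈ D.arc x then 1 else 0) + if x = y then 1 else 0 := by
  by_cases hxy : x = y
  · subst hxy
    simp [signedB, D.first_notMem_arc, D.second_notMem_arc]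
  · simp only [signedB, D.includesMinus_iff hxy, D.includesPlus_iff hF hxy]
    split_ifs <;> simp_all

theorem eq_first_or_eq_second_of_vert (hF : F.IsFourRegular) {K : F.Component} {h : H} {x : V}
    (hh : h ∈ (C.circuit K).dep) (hx : F.vert h = x) : h = D.first x ∨ h = D.second x :=
  hx ▸ D.eq_first_or_eq_second hF hh

theorem vert_ne_of_mem_coarc (hF : F.IsFourRegular) (x : V) {a : H} (ha : a ∈ D.coarc x) :
    F.vert a ≠ x := by
  intro hx
  have hn := D.nodup x
  rcases D.eq_first_or_eq_second_of_vert hF (h := a)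
    (K := F.toSimpleGraph.connectedComponentMk x) (by simp [D.dep_eq, ha]) hx with rfl | rfl
  · simp [ha] at hn
  · simp [List.nodup_append, ha] at hn

open Classical in
theorem count_map_vert (hF : F.IsFourRegular) {K : F.Component} {l : List H} (hl : l.Nodup)
    (hK : ∀ a ∈ l, a ∈ (C.circuit K).dep) (y : V) :
    (l.map F.vert).count y = (if D.second y ∈ l then 1 else 0) +
      (if D.first y ∈ l then 1 else 0) := by
  induction l with
  | nil => simp
  | cons a l ih =>
    have ih := ih hl.of_cons fun b hb => hK b (List.mem_cons_of_mem _ hb)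
    have ha := (List.nodup_cons.1 hl).1
    have hne := D.first_ne_second y
    rw [List.map_cons, List.count_cons, ih]
    by_cases hy : F.vert a = y
    · rcases D.eq_first_or_eq_second_of_vert hF (hK a (by simp)) hy with rfl | rfl
      · simp [ha, hy, hne.symm]
      · simp [ha, hy, hne]
        omega
    · have h1 : D.first y ≠ a := fun h => hy (h ▸ D.vert_first y)
      have h2 : D.second y ≠ a := fun h => hy (h ▸ D.vert_second y)
      simp [hy, h1, h2]

/-- The visits to `x` cut its circuit into two arcs, and interlacement means that the two visits to
`y` are separated. If `y` is in another component, neither departure is on the arc and both sides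
fail. -/
theorem interlaced_iff (hF : F.IsFourRegular) {x y : V} (hxy : x ≠ y) :
    C.Interlaced x y ↔ (D.first y ∈ D.arc x ↔ D.second y ∉ D.arc x) := by
  classical
  have hn := D.nodup x
  have hcount := D.count_map_vert hF (D.nodup x) (K := F.toSimpleGraph.connectedComponentMk x)
    (fun a ha => by rw [D.dep_eq]; exact ha) y
  have harc := D.count_map_vert hF (l := D.arc x) hn.of_append_left.of_cons
    (fun a ha => D.mem_circuit_of_mem_arc ha) y
  have hmem : C.Interlaced x y ∨ (D.first y ∈ D.arc x ∨ D.second y ∈ D.arc x) →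
      F.toSimpleGraph.connectedComponentMk y = F.toSimpleGraph.connectedComponentMk x := by
    rintro (⟨K, r, hr, hsub⟩ | h | h)
    · have hmem : ∀ z ∈ r, F.toSimpleGraph.connectedComponentMk z = K := by
        intro z hz
        rw [← Cycle.mem_coe_iff, hr, Cycle.mem_map] at hz
        obtain ⟨a, ha, rfl⟩ := hz
        exact C.component_eq_of_mem ha
      rw [hmem x (by rcases hsub with h | h <;> exact h.subset (by simp)),
        hmem y (by rcases hsub with h | h <;> exact h.subset (by simp))]
    · rw [← C.component_eq_of_mem (D.mem_circuit_of_mem_arc h), D.vert_first]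
    · rw [← C.component_eq_of_mem (D.mem_circuit_of_mem_arc h), D.vert_second]
  by_cases hK : F.toSimpleGraph.connectedComponentMk y = F.toSimpleGraph.connectedComponentMk x
  · have h1 := D.first_mem y
    have h2 := D.second_mem y
    rw [hK, D.dep_eq x, Cycle.mem_coe_iff] at h1 h2
    rw [if_pos h1, if_pos h2] at hcount
    have key := Cycle.exists_alternating_iff hxy (l := (D.arc x).map F.vert)
      (l' := (D.coarc x).map F.vert) (by simpa using D.vert_ne x)
      (by simpa using fun a ha => D.vert_ne_of_mem_coarc hF x ha)
      (by simpa [List.count_cons, D.vert_first, D.vert_second, hxy] using hcount)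
    have hmap : (C.circuit (F.toSimpleGraph.connectedComponentMk x)).dep.map F.vert =
        ((x :: (D.arc x).map F.vert ++ x :: (D.coarc x).map F.vert : List V) : Cycle V) := by
      rw [D.dep_eq x, Cycle.map_coe]
      simp [D.vert_first, D.vert_second]
    have hint : C.Interlaced x y ↔ ((D.arc x).map F.vert).count y = 1 := by
      rw [← key, ← hmap]
      refine ⟨?_, fun ⟨r, hr⟩ => ⟨_, r, hr⟩⟩
      rintro ⟨K, r, hr, hsub⟩
      have hx : x ∈ r := by rcases hsub with h | h <;> exact h.subset (by simp)
      rw [← Cycle.mem_coe_iff, hr, Cycle.mem_map] at hx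
      obtain ⟨a, ha, hax⟩ := hx
      obtain rfl := C.component_eq_of_mem ha
      rw [hax] at hr
      exact ⟨r, hr, hsub⟩
    rw [hint, harc]
    split_ifs <;> simp_all
  · have h1 : ¬ C.Interlaced x y := fun h => hK (hmem (Or.inl h))
    have h2 : D.first y ∉ D.arc x := fun h => hK (hmem (Or.inr (Or.inl h)))
    have h3 : D.second y ∉ D.arc x := fun h => hK (hmem (Or.inr (Or.inr h)))
    simp [h1, h2, h3]

/-- Off the diagonal, the difference and the sum of the two membership indicators both reduce to
their exclusive or, which is adjacency. -/
theorem signedIAS_map_zmod_two (hF : F.IsFourRegular) :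
    (C.signedIAS Γ).map (Int.cast : ℤ → ZMod 2) = IAS C.interlacementGraph := by
  classical
  have hadj : ∀ x y, C.interlacementGraph.Adj x y ↔ x ≠ y ∧
      (D.first y ∈ D.arc x ↔ D.second y ∉ D.arc x) := fun x y =>
    and_congr_right fun h => D.interlaced_iff hF h
  have h11 : (1 + 1 : ZMod 2) = 0 := rfl
  have hm1 : (-1 : ZMod 2) = 1 := rfl
  have h2 : (2 : ZMod 2) = 0 := rfl
  ext x ⟨y, i⟩
  by_cases hxy : x = y
  · subst hxy
    cases i <;> simp [signedIAS, IAS, blockMatrix, D.signedA_apply hF, D.signedB_apply hF,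
      D.first_notMem_arc, D.second_notMem_arc]
  · cases i <;> simp only [signedIAS, IAS, blockMatrix, D.signedA_apply hF, D.signedB_apply hF,
      Matrix.map_apply, Matrix.one_apply, Matrix.add_apply, SimpleGraph.adjMatrix_apply, hadj,
      if_neg hxy] <;> (try split_ifs) <;> simp_all

end HalfEdgeGraph.OrientedEulerSystem.Splitting

/-! ### Kernel vectors as potentials -/

/-- The jumps `a`, `b` of a potential at the passages of an Euler circuit through a vertex with
coordinate `c`, if the potential is constant along the transitions with the given label. -/
def IsoLabel.Jump {R : Type*} [Ring R] : IsoLabel → R → R → R → Prop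
  | .phi, _, a, b => a = 0 ∧ b = 0
  | .chi, c, a, b => a = -c ∧ b = c
  | .psi, c, a, b => a = c ∧ b = c

/-- The difference of the potential between the first and the last edge of the fundamental circuit
at a vertex with coordinate `c`. -/
def IsoLabel.gap {R : Type*} [Ring R] : IsoLabel → R → R
  | .phi, c => c
  | .chi, _ => 0
  | .psi, c => c

namespace HalfEdgeGraph.OrientedEulerSystem.Splitting

variable {V : Type u} {H : Type v} {F : HalfEdgeGraph V H} {C : F.OrientedEulerSystem}
  {Γ : V → F.OrientedCircuit} (D : C.Splitting Γ)
include D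

open Classical in
theorem sum_map_eq [Fintype V] {R : Type*} [AddCommMonoid R] (hF : F.IsFourRegular)
    {K : F.Component} {l : List H} (hl : l.Nodup) (hK : ∀ a ∈ l, a ∈ (C.circuit K).dep)
    (J : H → R) :
    (l.map J).sum = ∑ y, ((if D.second y ∈ l then J (D.second y) else 0) +
      (if D.first y ∈ l then J (D.first y) else 0)) := by
  induction l with
  | nil => simp
  | cons a l ih =>
    have ih := ih hl.of_cons fun b hb => hK b (List.mem_cons_of_mem _ hb)
    have ha := (List.nodup_cons.1 hl).1
    rw [List.map_cons, List.sum_cons, ih,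
      ← Fintype.sum_ite_eq' (F.vert a) (fun _ => J a), ← Finset.sum_add_distrib]
    refine Finset.sum_congr rfl fun y _ => ?_
    have hne := D.first_ne_second y
    by_cases hy : F.vert a = y
    · rcases D.eq_first_or_eq_second_of_vert hF (hK a (by simp)) hy with rfl | rfl
      · simp [ha, hy, hne.symm, add_comm]
      · simp [ha, hy, hne]
    · have h1 : D.first y ≠ a := fun h => hy (h ▸ D.vert_first y)
      have h2 : D.second y ≠ a := fun h => hy (h ▸ D.vert_second y)
      simp [Ne.symm hy, h1, h2]

/-- For `y ≠ x`, the entry times `z y` is the total jump at those departures from `y` that lie on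
the arc. The arc has no departure from `x`, so the diagonal term is exactly the gap. -/
theorem row_sum_eq [Fintype V] {R : Type*} [Ring R] (hF : F.IsFourRegular) (τ : V → IsoLabel)
    (z : V → R) (J : H → R) (hJ : ∀ y, (τ y).Jump (z y) (J (D.first y)) (J (D.second y))) (x : V) :
    ∑ y, ((C.signedIAS Γ x (y, τ y) : ℤ) : R) * z y =
      ((D.arc x).map J).sum + (τ x).gap (z x) := by
  classical
  rw [D.sum_map_eq hF (D.nodup x).of_append_left.of_cons (fun a => D.mem_circuit_of_mem_arc),
    ← Fintype.sum_ite_eq x (fun y => (τ y).gap (z y)), ← Finset.sum_add_distrib]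
  refine Finset.sum_congr rfl fun y _ => ?_
  have h := hJ y
  generalize τ y = i at h ⊢
  have hx1 := D.first_notMem_arc x
  have hx2 := D.second_notMem_arc x
  cases i <;> obtain ⟨h1, h2⟩ := h <;>
    simp only [signedIAS, blockMatrix, D.signedA_apply hF, D.signedB_apply hF, h1, h2,
      IsoLabel.gap, Matrix.one_apply] <;> (split_ifs <;> simp_all)
  -- The ψ column with both departures on the arc, where the entry is 2.
  exact two_mul _

/-- A function on the departures that is a potential of the transitions `τ` with coordinates
`z`. -/
structure IsPotential {R : Type*} [Ring R] (τ : V → IsoLabel) (z : V → R) (g : H → R) : Prop where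
  jump : ∀ y, (τ y).Jump (z y) (g (D.first y) - g (C.prev (D.first y)))
    (g (D.second y) - g (C.prev (D.second y)))
  gap : ∀ y, g (D.first y) - g (C.prev (D.second y)) = (τ y).gap (z y)

omit D in
theorem isChain_of_prev {R : Type*} [AddCommGroup R] {K : F.Component} {l s : List H}
    (h : (C.circuit K).dep = ((l ++ s : List H) : Cycle H)) (g : H → R) :
    l.IsChain fun a b => g b = g a + (g b - g (C.prev b)) := by
  rw [List.isChain_iff_forall_rel_of_append_cons_cons]
  rintro a b t t' rfl
  rw [C.prev_eq_of_append (s := t) (a := a) (b := b) (t := t' ++ s) (by rw [h]; simp)]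
  abel

variable {D} in
-- The jumps along the arc telescope to the last value minus the first, which is minus the gap.
theorem IsPotential.row_sum_eq_zero [Fintype V] {R : Type*} [Ring R] (hF : F.IsFourRegular)
    {τ : V → IsoLabel} {z : V → R} {g : H → R} (hg : D.IsPotential τ z g) (x : V) :
    ∑ y, ((C.signedIAS Γ x (y, τ y) : ℤ) : R) * z y = 0 := by
  rw [D.row_sum_eq hF τ z (fun h => g h - g (C.prev h)) hg.jump x, ← hg.gap x, D.prev_second x,
    (isChain_of_prev (D.dep_eq x) g).getLast_eq_add_sum (J := fun h => g h - g (C.prev h))]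
  abel

/-- A kernel vector over the field with two elements comes from a potential. -/
theorem exists_isPotential [Fintype V] (hF : F.IsFourRegular)
    (τ : V → IsoLabel) (z : V → ZMod 2)
    (hz : ∀ x, ∑ y, ((C.signedIAS Γ x (y, τ y) : ℤ) : ZMod 2) * z y = 0) :
    ∃ g : H → ZMod 2, D.IsPotential τ z g := by
  classical
  -- Modulo 2 the sign in the χ jump disappears, so both departures from a vertex carry the same
  -- jump.
  let c : V → ZMod 2 := fun y => if τ y = .phi then 0 else z y
  let J : H → ZMod 2 := fun h => c (F.vert h)
  have hJ : ∀ y, (τ y).Jump (z y) (J (D.first y)) (J (D.second y)) := by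
    intro y
    simp only [J, c, D.vert_first, D.vert_second]
    generalize τ y = i
    cases i <;> simp [IsoLabel.Jump]
  have hsum := fun x => (D.row_sum_eq hF τ z J hJ x).symm.trans (hz x)
  have hK : ∀ K : F.Component, ∃ g : H → ZMod 2, ∀ h ∈ (C.circuit K).dep,
      g h - g (C.prev h) = J h := by
    intro K
    obtain ⟨a, ha⟩ : ∃ a, a ∈ (C.circuit K).dep := by
      have := (C.circuit K).ne_nil
      revert this
      induction (C.circuit K).dep using Cycle.induction_on with
      | nil => exact fun h => absurd rfl h
      | cons a l => exact fun _ => ⟨a, by simp⟩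
    obtain ⟨l, hl⟩ := Cycle.exists_eq_coe_cons ha
    have hnd := (C.circuit K).nodup_of_dep_eq hl
    obtain ⟨g, hg⟩ := List.exists_isChain_add J hnd
    -- The only obstruction to closing the potential up around the circuit. Each vertex contributes
    -- its jump twice, which is zero in characteristic 2; over ℝ the ψ jumps need not cancel.
    have htot : ((a :: l).map J).sum = 0 := by
      rw [D.sum_map_eq hF hnd (K := K) (fun b hb => by rw [hl]; exact hb)]
      refine Finset.sum_eq_zero fun y _ => ?_
      have hmem : ∀ h, h ∈ a :: l ↔ F.toSimpleGraph.connectedComponentMk (F.vert h) = K ∧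
          h ∈ (C.circuit (F.toSimpleGraph.connectedComponentMk (F.vert h))).dep := by
        intro h
        rw [← Cycle.mem_coe_iff, ← hl]
        exact ⟨fun hh => ⟨C.component_eq_of_mem hh, (C.component_eq_of_mem hh).symm ▸ hh⟩,
          fun hh => hh.1 ▸ hh.2⟩
      simp only [hmem, D.vert_first, D.vert_second, D.first_mem, D.second_mem, J, and_true]
      split_ifs <;> simp [CharTwo.add_self_eq_zero]
    have hlast := hg.getLast_eq_add_sum
    refine ⟨g, fun h hh => ?_⟩
    rw [hl, Cycle.mem_coe_iff] at hh
    obtain ⟨s, t, hst⟩ := List.append_of_mem hh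
    rcases s.eq_nil_or_concat with rfl | ⟨s, b, rfl⟩
    · obtain ⟨rfl, rfl⟩ := List.cons.inj hst
      rw [C.prev_eq_getLast hl, hlast]
      rw [List.map_cons, List.sum_cons] at htot
      rw [eq_neg_of_add_eq_zero_left htot]
      abel
    · rw [List.concat_eq_append, List.append_assoc, List.singleton_append] at hst
      rw [hst] at hl hg
      rw [C.prev_eq_of_append hl, List.isChain_iff_forall_rel_of_append_cons_cons.1 hg rfl]
      abel
  choose g hg using hK
  have hg' : ∀ (K : F.Component) (h : H), h ∈ (C.circuit K).dep →
      g (F.toSimpleGraph.connectedComponentMk (F.vert h)) h = g K h := fun K h hh => by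
    rw [C.component_eq_of_mem hh]
  refine ⟨fun h => g (F.toSimpleGraph.connectedComponentMk (F.vert h)) h, ⟨fun y => ?_, fun y => ?_⟩⟩
  · have h1 := D.first_mem y
    have h2 := D.second_mem y
    simp only [hg' _ _ h1, hg' _ _ (C.prev_mem h1), hg' _ _ h2, hg' _ _ (C.prev_mem h2),
      hg _ _ h1, hg _ _ h2]
    exact hJ y
  · have h1 := D.first_mem y
    have h2 := C.prev_mem (D.second_mem y)
    simp only [hg' _ _ h1, hg' _ _ h2]
    have hch : (D.first y :: D.arc y).IsChain fun a b =>
        g (F.toSimpleGraph.connectedComponentMk y) b =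
          g (F.toSimpleGraph.connectedComponentMk y) a + J b := by
      rw [List.isChain_iff_forall_rel_of_append_cons_cons]
      intro a b t t' ht
      have hd := D.dep_eq y
      rw [ht, List.append_assoc, List.cons_append, List.cons_append] at hd
      rw [← hg (F.toSimpleGraph.connectedComponentMk y) b (by simp [hd]), C.prev_eq_of_append hd]
      abel
    -- Here the kernel equation of row `y` enters: it is the gap condition.
    rw [D.prev_second, hch.getLast_eq_add_sum, eq_neg_of_add_eq_zero_left (hsum y)]
    abel

variable {D} in
/-- A potential over the field with two elements lifts to a real one. -/
theorem IsPotential.exists_lift {τ : V → IsoLabel} {z : V → ZMod 2} {g : H → ZMod 2}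
    (hg : D.IsPotential τ z g) : ∃ (z' : V → ℝ) (g' : H → ℝ), D.IsPotential τ z' g' ∧
      ∀ y, z' y = 0 ↔ z y = 0 := by
  -- Only the injectivity of this lift is used; it need not be additive.
  let f : ZMod 2 → ℝ := fun a => a.val
  have hf : Function.Injective f := fun a b h =>
    ZMod.val_injective 2 (Nat.cast_injective (R := ℝ) h)
  let z' : V → ℝ := fun y => match τ y with
    | .phi => f (g (D.first y)) - f (g (C.prev (D.second y)))
    | .chi => f (g (D.second y)) - f (g (C.prev (D.second y)))
    | .psi => f (g (D.first y)) - f (g (C.prev (D.first y)))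
  -- With `a → b` and `c → d` the two passages, the conditions amount to two equalities: `a = b`, `c
  -- = d` for φ; `b = c`, `a = d` for χ; `a = c`, `b = d` for ψ. Any map preserves these, and an
  -- injective one preserves whether the two common values differ, that is, whether the coordinate
  -- vanishes.
  have key : ∀ (i : IsoLabel) (a b c d e : ZMod 2) (r : ℝ),
      i.Jump e (b - a) (d - c) → b - c = i.gap e →
      r = (match i with | .phi => f b - f c | .chi => f d - f c | .psi => f b - f a) →
      (i.Jump r (f b - f a) (f d - f c) ∧ f b - f c = i.gap r) ∧ (r = 0 ↔ e = 0) := by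
    intro i a b c d e r h1 h2 hr
    cases i <;> simp only [IsoLabel.Jump, IsoLabel.gap] at h1 h2 hr ⊢ <;> obtain ⟨h1, h3⟩ := h1
    · obtain rfl := sub_eq_zero.1 h1
      obtain rfl := sub_eq_zero.1 h3
      subst h2 hr
      simp [sub_eq_zero, hf.eq_iff]
    · obtain rfl := sub_eq_zero.1 h2
      obtain rfl : a = d := by linear_combination -h1 - h3
      subst h3 hr
      simp [sub_eq_zero, hf.eq_iff]
    · obtain rfl : a = c := by linear_combination h2 - h1
      obtain rfl : b = d := by linear_combination h1 - h3
      subst h1 hr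
      simp [sub_eq_zero, hf.eq_iff]
  have key' := fun y => key (τ y) _ _ _ _ _ (z' y) (hg.jump y) (hg.gap y) rfl
  exact ⟨z', fun h => f (g h), ⟨fun y => (key' y).1.1, fun y => (key' y).1.2⟩, fun y => (key' y).2⟩

end HalfEdgeGraph.OrientedEulerSystem.Splitting

/-! ### Relabelling, rank, and the sheltering matroid -/

theorem linearIndepOn_submatrix_col_iff {m m' E E' K : Type*} [Field K] (A : Matrix m E K)
    (r : m' ≃ m) {f : E' → E} (hf : Function.Injective f) (I : Set E') :
    LinearIndepOn K (A.submatrix r f).col I ↔ LinearIndepOn K A.col (f '' I) := by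
  have h1 : LinearIndepOn K A.col (f '' I) ↔ LinearIndepOn K (A.col ∘ f) I :=
    ⟨fun h => h.comp_of_image hf.injOn, fun h => h.image_of_comp⟩
  rw [h1]
  exact LinearMap.linearIndependent_iff (LinearEquiv.funCongrLeft K K r).toLinearMap
    (LinearEquiv.ker _) (v := fun i : I => A.col (f i))

theorem eRank_matrixMatroid_blockMatrix_one {V K : Type*} [Finite V] [DecidableEq V] [Field K]
    (Q S : Matrix V V K) : (matrixMatroid (blockMatrix 1 Q S)).eRank = ENat.card V := by
  have := Fintype.ofFinite V
  refine le_antisymm ?_ ?_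
  · rw [← Matroid.eRk_ground, Matroid.eRk_le_iff]
    intro I _ hI
    have := Fintype.ofFinite I
    have h := (show LinearIndependent K _ from hI).fintype_card_le_finrank
    rw [Module.finrank_fintype_fun_eq_card] at h
    rw [Set.encard, ENat.card_eq_coe_fintype_card, ENat.card_eq_coe_fintype_card]
    exact_mod_cast h
  · have hinj : Function.Injective fun y : V => (y, IsoLabel.phi) := fun a b h =>
      congrArg Prod.fst h
    refine hinj.encard_range.trans (Matroid.Indep.encard_le_eRank ?_)
    rw [matrixMatroid_indep, linearIndepOn_col_iff_of_section _ (fun _ => IsoLabel.phi)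
      (by rintro _ ⟨y, rfl⟩; rfl)]
    intro z _ hz
    ext x
    simpa [blockMatrix, Matrix.one_apply] using hz x

theorem exists_section_of_isSubtransversal {V : Type u} [Finite V] {G : SimpleGraph V}
    {S : Set (IsoGround V)} (hS : IsSubtransversal (isotropicThreeMatroid G).Ω S) :
    ∃ τ : V → IsoLabel, ∀ e ∈ S, e.2 = τ e.1 := by
  obtain ⟨T, hT, hST⟩ := hS
  choose t _ ht using fun x : V => hT _ ⟨x, rfl⟩
  refine ⟨fun x => (t x).2, ?_⟩
  rintro ⟨x, i⟩ he
  exact congrArg Prod.snd (ht x (x, i) ⟨hST he, by cases i <;> simp⟩)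

namespace HalfEdgeGraph.OrientedEulerSystem

variable {V : Type u} {H : Type v} {F : HalfEdgeGraph V H} {C : F.OrientedEulerSystem}
  {Γ : V → F.OrientedCircuit}

/-- A dependence modulo 2 passes through potentials to a real one with the same support, hence still
within `I`; the other direction is reduction modulo 2. -/
theorem linearIndepOn_signedIAS_iff [Finite V] (hF : F.IsFourRegular)
    (hΓ : ∀ x, C.IsFundamentalCircuit x (Γ x)) {I : Set (IsoGround V)} {τ : V → IsoLabel}
    (hI : ∀ e ∈ I, e.2 = τ e.1) :
    LinearIndepOn ℝ ((C.signedIAS Γ).map (Int.cast : ℤ → ℝ)).col I ↔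
      LinearIndepOn (ZMod 2) (IAS C.interlacementGraph).col I := by
  have := Fintype.ofFinite V
  have := Fintype.ofFinite I
  obtain ⟨D⟩ := C.exists_splitting hΓ
  rw [← D.signedIAS_map_zmod_two hF]
  refine ⟨fun h => ?_, fun h =>
    linearIndependent_intCast_of_zmod_two (fun (i : I) x => C.signedIAS Γ x i) h⟩
  rw [linearIndepOn_col_iff_of_section _ τ hI] at h ⊢
  intro z hzI hz
  obtain ⟨g, hg⟩ := D.exists_isPotential hF τ z hz
  obtain ⟨z', g', hg', hzz⟩ := hg.exists_lift
  have hz' := h z' (fun y hy => (hzz y).2 (hzI y hy)) (hg'.row_sum_eq_zero hF)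
  ext y
  exact (hzz y).1 (congrFun hz' y)

theorem signedIAS_isStrictShelteringMatroid [Finite V] (hF : F.IsFourRegular)
    (hΓ : ∀ x, C.IsFundamentalCircuit x (Γ x)) :
    IsStrictShelteringMatroid C.interlacementGraph
      (matrixMatroid ((C.signedIAS Γ).map (Int.cast : ℤ → ℝ))) := by
  classical
  refine ⟨⟨rfl, fun S => ?_⟩, ?_⟩
  · obtain ⟨τ, hτ⟩ := exists_section_of_isSubtransversal S.2
    exact Matroid.eRk_eq_of_indep_iff fun I hI =>
      linearIndepOn_signedIAS_iff hF hΓ fun e he => hτ e (hI he)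
  · have : (C.signedIAS Γ).map (Int.cast : ℤ → ℝ) = blockMatrix 1
        ((C.signedA Γ).map (Int.cast : ℤ → ℝ)) ((C.signedB Γ).map (Int.cast : ℤ → ℝ)) := by
      ext x ⟨y, i⟩
      cases i <;> simp [signedIAS, blockMatrix, Matrix.one_apply]
    rw [this, eRank_matrixMatroid_blockMatrix_one]

end HalfEdgeGraph.OrientedEulerSystem

theorem IsCircleGraph.isRepresentable_real {V : Type u} [Finite V] {G : SimpleGraph V}
    (hG : IsCircleGraph G) : (isotropicThreeMatroid G).IsRepresentable ℝ := by
  classical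
  obtain ⟨V', H, _, F, hF, C, ⟨e⟩⟩ := hG
  choose Γ hΓ using C.exists_isFundamentalCircuit hF
  let f : IsoGround V → IsoGround V' := Prod.map e id
  have hf : Function.Injective f := e.injective.prodMap Function.injective_id
  have hadj : ∀ x y, C.interlacementGraph.Adj (e x) (e y) ↔ G.Adj x y := fun _ _ =>
    e.map_rel_iff
  -- The isomorphism relabels rows and columns alike, so independence for `G` is independence of the
  -- image columns for the interlacement graph.
  have hIAS : IAS G = (IAS C.interlacementGraph).submatrix e.toEquiv f := by
    ext x ⟨y, i⟩
    cases i <;> simp [IAS, blockMatrix, f, Matrix.one_apply, hadj]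
  refine ⟨Nat.card V', ((C.signedIAS Γ).map (Int.cast : ℤ → ℝ)).submatrix
    (Finite.equivFin V').symm f, rfl, fun S => ?_⟩
  obtain ⟨τ, hτ⟩ := exists_section_of_isSubtransversal S.2
  refine Matroid.eRk_eq_of_indep_iff fun I hI => ?_
  rw [matrixMatroid_indep, matrixMatroid_indep, hIAS, linearIndepOn_submatrix_col_iff _ _ hf,
    linearIndepOn_submatrix_col_iff _ _ hf]
  refine HalfEdgeGraph.OrientedEulerSystem.linearIndepOn_signedIAS_iff hF hΓ
    (τ := fun x => τ (e.symm x)) ?_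
  rintro _ ⟨a, ha, rfl⟩
  simpa [f] using hτ a (hI ha)

theorem mainTheorem8 :
    (∀ {V : Type u} {H : Type v} [Finite V] (F : HalfEdgeGraph V H) (_ : F.IsFourRegular)
      (C : F.OrientedEulerSystem) (Γ : V → F.OrientedCircuit)
      (_ : ∀ x : V, C.IsFundamentalCircuit x (Γ x)),
      IsStrictShelteringMatroid C.interlacementGraph
        (matrixMatroid ((C.signedIAS Γ).map (Int.cast : ℤ → ℝ)))) ∧
    (∀ {V : Type w} [Finite V] (G : SimpleGraph V), IsCircleGraph G →
      (isotropicThreeMatroid G).IsRepresentable ℝ) := by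
  exact ⟨fun F hF C Γ hΓ =>
      HalfEdgeGraph.OrientedEulerSystem.signedIAS_isStrictShelteringMatroid hF hΓ,
    fun G hG => hG.isRepresentable_real⟩
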